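/- Let $\ell\ge 2$ be an integer. For $\lambda\ge 1$ and $x\in\mathbb{R}$ let $$\Gamma_{\ell,\lambda}(x)=\{(y,r):\ \lambda^{-1}<r\le \lambda^{-1/\ell},\ |y-x|\le(\lambda r)^{-1/(\ell-1)}\},$$ and for a measurable function $f:\mathbb{R}\to\mathbb{C}$ let $$\mathcal{M}_{\ell,\lambda}f(x)=\sup_{(y,r)\in\Gamma_{\ell,\lambda}(x)}\frac{1}{(\lambda r)^{1/(\ell-1)}}\int_{|y-y'|\le r}|f(y')|\,dy'\in[0,\infty],$$ where the supremum over the empty set is $0$. Let $p=(\ell/2)'$ be the exponent conjugate to $\ell/2$, that is, $p=\ell/(\ell-2)$ if $\ell>2$ and $p=\infty$ if $\ell=2$. Then there is a constant $C>0$, depending only on $\ell$, such that for all $\lambda\ge 1$ and all $f\in L^{p}(\mathbb{R})$ one has $\mathcal{M}_{\ell,\lambda}f\in L^{p}(\mathbb{R})$ and $$\|\mathcal{M}_{\ell,\lambda}f\|_{L^{p}(\mathbb{R})}\le C\,\lambda^{-2/\ell}\,\|f\|_{L^{p}(\mathbb{R})}.$$ -/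

import Mathlib

open MeasureTheory
open scoped ENNReal

/-- The approach region `Γ_{ℓ,λ}(x)`: all pairs `(y, r)` with `λ⁻¹ < r ≤ λ^{-1/ℓ}` and
`|y - x| ≤ (λ r)^{-1/(ℓ-1)}`. -/
def approachRegion (ℓ : ℕ) (lam x : ℝ) : Set (ℝ × ℝ) :=
  {q | lam⁻¹ < q.2 ∧ q.2 ≤ lam ^ (-(1 / (ℓ : ℝ))) ∧
    |q.1 - x| ≤ (lam * q.2) ^ (-(1 / ((ℓ : ℝ) - 1)))}

/-- The fractional maximal function of a weight `w`:
`sup_{(y,r) ∈ Γ_{ℓ,λ}(x)} (λ r)^{-1/(ℓ-1)} ∫_{|y-y'| ≤ r} w(y') dy'`, with values in `[0,∞]`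
(the supremum over an empty region is `0`). -/
noncomputable def fracMaximal (ℓ : ℕ) (lam : ℝ) (w : ℝ → ℝ≥0∞) (x : ℝ) : ℝ≥0∞ :=
  ⨆ q ∈ approachRegion ℓ lam x,
    (∫⁻ y' in {y' : ℝ | |q.1 - y'| ≤ q.2}, w y') /
      ENNReal.ofReal ((lam * q.2) ^ (1 / ((ℓ : ℝ) - 1)))

/-! Write `s(r) = (λ r)^{-1/(ℓ-1)}`, `w = |f|`, and let `A` be the average of `w` over the interval
of centre `y` and radius `r`. The quantity in the supremum is `2 r s(r) A`, and for `p = ℓ/(ℓ-2)`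
one has `(r s(r))^p = λ^{-2p/ℓ} r / s(r)`. So it suffices to bound the integral of `sup (r/s(r))
A^p` by that of `w^p`. Split `A^p` into the powers `2^{kp}` with `2^k < A`; for each such `k` the
interval lies in the open level set `E_k` of averages exceeding `2^k`. The Carleson estimate
`exists_majorant_of_isOpen` bounds the supremum of `r/s(r)` over such intervals by a function of
integral at most `20 |E_k|`, and `∑ 2^{kp} |E_k|` is controlled by the Hardy–Littlewood theorem. For
`ℓ = 2` the bound is immediate, since `r s(r) = λ⁻¹`. -/

/-- The indices `(y, r)` of the intervals on which the average of `w` exceeds `t`. -/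
def averageIndices (w : ℝ → ℝ≥0∞) (t : ℝ≥0∞) : Set (ℝ × ℝ) :=
  {q | 0 < q.2 ∧ t * ENNReal.ofReal (2 * q.2) < ∫⁻ y in Metric.closedBall q.1 q.2, w y}

/-- The union of the open intervals on whose closure the average of `w` exceeds `t`. -/
def averageLevelSet (w : ℝ → ℝ≥0∞) (t : ℝ≥0∞) : Set ℝ :=
  ⋃ q ∈ averageIndices w t, Metric.ball q.1 q.2

theorem isOpen_averageLevelSet (w : ℝ → ℝ≥0∞) (t : ℝ≥0∞) : IsOpen (averageLevelSet w t) :=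
  isOpen_biUnion fun _ _ => Metric.isOpen_ball

/-! ### Weak type bound by Vitali covering -/

/-- On an interval with large average, the large values of `w` carry half of the mass. -/
theorem mul_radius_le_setLIntegral_of_mem_averageIndices {w : ℝ → ℝ≥0∞} (hw : Measurable w)
    {t : ℝ≥0∞} (ht : t ≠ ⊤) {q : ℝ × ℝ} (hq : q ∈ averageIndices w t) :
    t * ENNReal.ofReal q.2 ≤
      ∫⁻ y in Metric.closedBall q.1 q.2, {z | t / 2 < w z}.indicator w y := by
  obtain ⟨hr, hlt⟩ := hq
  have hS : MeasurableSet {z | t / 2 < w z} := measurableSet_lt measurable_const hw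
  have hpt : ∀ y, w y ≤ t / 2 + {z | t / 2 < w z}.indicator w y := by
    intro y
    by_cases hy : t / 2 < w y
    · rw [Set.indicator_of_mem (show y ∈ {z | t / 2 < w z} from hy)]
      exact le_add_self
    · exact le_add_right (not_lt.1 hy)
  have h1 : ∫⁻ y in Metric.closedBall q.1 q.2, w y ≤ t / 2 * ENNReal.ofReal (2 * q.2) +
      ∫⁻ y in Metric.closedBall q.1 q.2, {z | t / 2 < w z}.indicator w y := by
    refine (lintegral_mono hpt).trans ?_
    rw [lintegral_add_left measurable_const, setLIntegral_const, Real.volume_closedBall]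
  have h2 : t / 2 * ENNReal.ofReal (2 * q.2) = t * ENNReal.ofReal q.2 := by
    rw [ENNReal.ofReal_mul zero_le_two, ENNReal.ofReal_ofNat, ← mul_assoc,
      ENNReal.div_mul_cancel two_ne_zero ENNReal.ofNat_ne_top]
  have h3 : t * ENNReal.ofReal (2 * q.2) = t * ENNReal.ofReal q.2 + t * ENNReal.ofReal q.2 := by
    rw [two_mul, ENNReal.ofReal_add hr.le hr.le, mul_add]
  rw [h2] at h1
  rw [h3] at hlt
  exact (ENNReal.add_le_add_iff_left (ENNReal.mul_ne_top ht ENNReal.ofReal_ne_top)).1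
    (hlt.le.trans h1)

/-- The weak type `(1,1)` inequality for the Hardy–Littlewood maximal function, restricted to
the large values of the weight. -/
theorem volume_averageLevelSet_le {w : ℝ → ℝ≥0∞} (hw : Measurable w) {t : ℝ≥0∞}
    (ht0 : t ≠ 0) (ht : t ≠ ⊤) :
    volume (averageLevelSet w t) ≤ 10 * t⁻¹ * ∫⁻ y, {z | t / 2 < w z}.indicator w y := by
  set S := ∫⁻ y, {z | t / 2 < w z}.indicator w y with hSdef
  set v := {z | t / 2 < w z}.indicator w with hv
  have key : ∀ q ∈ averageIndices w t, ENNReal.ofReal q.2 ≤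
      t⁻¹ * ∫⁻ y in Metric.closedBall q.1 q.2, v y := by
    intro q hq
    rw [← ENNReal.div_eq_inv_mul, ENNReal.le_div_iff_mul_le (Or.inl ht0) (Or.inl ht), mul_comm]
    exact mul_radius_le_setLIntegral_of_mem_averageIndices hw ht hq
  rcases eq_or_ne S ⊤ with hS | hS
  · have : (10 * t⁻¹ : ℝ≥0∞) ≠ 0 := by simp [ht]
    rw [hS, ENNReal.mul_top this]
    exact le_top
  have hfin : t⁻¹ * S ≠ ⊤ := ENNReal.mul_ne_top (ENNReal.inv_ne_top.2 ht0) hS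
  -- The covering lemma needs bounded radii; finiteness of `S` supplies the bound.
  have hbdd : ∀ q ∈ averageIndices w t, q.2 ≤ (t⁻¹ * S).toReal := by
    intro q hq
    rw [← ENNReal.ofReal_le_iff_le_toReal hfin]
    exact (key q hq).trans (mul_le_mul_right (setLIntegral_le_lintegral _ _) _)
  obtain ⟨u, hut, hdisj, hcov⟩ := Vitali.exists_disjoint_subfamily_covering_enlargement_closedBall
    (averageIndices w t) Prod.fst Prod.snd _ hbdd 5 (by norm_num)
  have hcount : u.Countable := hdisj.countable_of_nonempty_interior fun q hq =>
    (Metric.nonempty_ball.2 (hut hq).1).mono Metric.ball_subset_interior_closedBall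
  have hsub : averageLevelSet w t ⊆ ⋃ q ∈ u, Metric.closedBall q.1 (5 * q.2) := by
    refine Set.iUnion₂_subset fun q hq => ?_
    obtain ⟨b, hb, hqb⟩ := hcov q hq
    exact (Metric.ball_subset_closedBall.trans hqb).trans
      (Set.subset_biUnion_of_mem (u := fun q : ℝ × ℝ => Metric.closedBall q.1 (5 * q.2)) hb)
  calc volume (averageLevelSet w t)
      ≤ ∑' q : u, volume (Metric.closedBall q.1.1 (5 * q.1.2)) :=
        (measure_mono hsub).trans (measure_biUnion_le _ hcount _)
    _ ≤ ∑' q : u, 10 * t⁻¹ * ∫⁻ y in Metric.closedBall q.1.1 q.1.2, v y := by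
        refine ENNReal.tsum_le_tsum fun q => ?_
        rw [Real.volume_closedBall, ← mul_assoc, ENNReal.ofReal_mul (by norm_num), mul_assoc]
        refine mul_le_mul' ?_ (key q (hut q.2))
        rw [← ENNReal.ofReal_ofNat 10]
        exact ENNReal.ofReal_le_ofReal (by norm_num)
    _ = 10 * t⁻¹ * ∫⁻ y in ⋃ q ∈ u, Metric.closedBall q.1 q.2, v y := by
        rw [ENNReal.tsum_mul_left, lintegral_biUnion hcount
          (fun _ _ => Metric.isClosed_closedBall.measurableSet) hdisj]
    _ ≤ 10 * t⁻¹ * S := mul_le_mul_right (setLIntegral_le_lintegral _ _) _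

/-! ### Dyadic decomposition of powers -/

/-- The sum of the dyadic powers below a finite number is comparable to the power of it. -/
theorem tsum_zpow_rpow_lt_le {q : ℝ} (hq : 0 < q) {u : ℝ≥0∞} (hu : u ≠ ⊤) :
    ∑' k : ℤ, (if (2 : ℝ≥0∞) ^ k < u then ((2 : ℝ≥0∞) ^ k) ^ q else 0) ≤
      (1 - 2 ^ (-q))⁻¹ * u ^ q := by
  rcases eq_or_ne u 0 with rfl | h0
  · simp
  obtain ⟨m, hm1, hm2⟩ := ENNReal.exists_mem_Ioc_zpow h0 hu ENNReal.one_lt_two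
    ENNReal.ofNat_ne_top
  have htwo : (2 : ℝ≥0∞) ≠ 0 := two_ne_zero
  have hlt : ∀ k : ℤ, (2 : ℝ≥0∞) ^ k < u → k ≤ m := by
    intro k hk
    by_contra! h
    exact absurd (hk.trans_le hm2)
      (not_lt.2 (ENNReal.zpow_le_of_le ENNReal.one_lt_two.le (by omega)))
  have hinj : Function.Injective (fun n : ℕ => m - (n : ℤ)) := fun a b h => by
    simpa using h
  have hsupp : Function.support
      (fun k : ℤ => if (2 : ℝ≥0∞) ^ k < u then ((2 : ℝ≥0∞) ^ k) ^ q else 0) ⊆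
      Set.range (fun n : ℕ => m - (n : ℤ)) := by
    intro k hk
    have : k ≤ m := hlt k (by by_contra h; simp [h] at hk)
    exact ⟨(m - k).toNat, by simp only; omega⟩
  rw [← hinj.tsum_eq hsupp]
  calc _ ≤ ∑' n : ℕ, ((2 : ℝ≥0∞) ^ (-q)) ^ n * u ^ q := by
        refine ENNReal.tsum_le_tsum fun n => ?_
        split_ifs
        · rw [ENNReal.zpow_sub htwo ENNReal.ofNat_ne_top, ENNReal.mul_rpow_of_nonneg _ _ hq.le,
            mul_comm]
          refine mul_le_mul' (le_of_eq ?_) (ENNReal.rpow_le_rpow hm1.le hq.le)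
          rw [zpow_natCast, ENNReal.inv_rpow, ← ENNReal.rpow_natCast, ← ENNReal.rpow_natCast,
            ← ENNReal.rpow_mul, ← ENNReal.rpow_mul, ← ENNReal.rpow_neg]
          ring_nf
        · exact zero_le
    _ = _ := by rw [ENNReal.tsum_mul_right, ENNReal.tsum_geometric]

/-- A power is dominated by the sum of the dyadic powers below. -/
theorem rpow_le_tsum_zpow_rpow {q : ℝ} (hq : 0 < q) (u : ℝ≥0∞) :
    u ^ q ≤ 2 ^ q * ∑' k : ℤ, (if (2 : ℝ≥0∞) ^ k < u then ((2 : ℝ≥0∞) ^ k) ^ q else 0) := by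
  have aux : ∀ u : ℝ≥0∞, u ≠ ⊤ → u ^ q ≤
      2 ^ q * ∑' k : ℤ, (if (2 : ℝ≥0∞) ^ k < u then ((2 : ℝ≥0∞) ^ k) ^ q else 0) := by
    intro u hu
    rcases eq_or_ne u 0 with rfl | h0
    · simp [hq]
    obtain ⟨m, hm1, hm2⟩ := ENNReal.exists_mem_Ioc_zpow h0 hu ENNReal.one_lt_two
      ENNReal.ofNat_ne_top
    calc u ^ q ≤ ((2 : ℝ≥0∞) ^ (m + 1)) ^ q := ENNReal.rpow_le_rpow hm2 hq.le
      _ = 2 ^ q * (if (2 : ℝ≥0∞) ^ m < u then ((2 : ℝ≥0∞) ^ m) ^ q else 0) := by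
        rw [if_pos hm1, ← ENNReal.mul_rpow_of_nonneg _ _ hq.le,
          ENNReal.zpow_add two_ne_zero ENNReal.ofNat_ne_top, zpow_one, mul_comm]
      _ ≤ _ := mul_le_mul_right
        (ENNReal.le_tsum (f := fun k : ℤ =>
          if (2 : ℝ≥0∞) ^ k < u then ((2 : ℝ≥0∞) ^ k) ^ q else 0) m) _
  rcases eq_or_ne u ⊤ with rfl | hu
  -- For `u = ⊤` the sum dominates the one for every finite `a`; taking `a = b ^ q⁻¹` with `b`
  -- arbitrary shows that it is infinite.
  · have h : ∀ a : ℝ≥0∞, a ≠ ⊤ → a ^ q ≤ 2 ^ q * ∑' k : ℤ,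
        (if (2 : ℝ≥0∞) ^ k < ⊤ then ((2 : ℝ≥0∞) ^ k) ^ q else 0) := fun a ha =>
      (aux a ha).trans (mul_le_mul_right (ENNReal.tsum_le_tsum fun k => by
        split_ifs with h1 h2
        · exact le_rfl
        · exact absurd (h1.trans (lt_top_iff_ne_top.2 ha)) h2
        · exact zero_le
        · exact le_rfl) _)
    rw [ENNReal.top_rpow_of_pos hq, top_le_iff]
    refine ENNReal.eq_top_of_forall_nnreal_le fun b => ?_
    have := h ((b : ℝ≥0∞) ^ q⁻¹) (ENNReal.rpow_ne_top_of_nonneg (by positivity) ENNReal.coe_ne_top)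
    rwa [← ENNReal.rpow_mul, inv_mul_cancel₀ hq.ne', ENNReal.rpow_one] at this
  · exact aux u hu

/-! ### Carleson estimate on open sets -/

/-- A majorant of `sup r / s(r)` over the radii `r ≤ L` with `|x - c| ≤ s(r) + L`. -/
noncomputable def radiusMajorant (s : ℝ → ℝ) (c L x : ℝ) : ℝ≥0∞ :=
  (Metric.closedBall c (2 * L)).indicator 1 x +
    ∑' n : ℕ, (Metric.closedBall c (2 * s (L / 2 ^ (n + 1)))).indicator
      (fun _ => ENNReal.ofReal (L / 2 ^ n / s (L / 2 ^ n))) x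

theorem measurable_radiusMajorant (s : ℝ → ℝ) (c L : ℝ) : Measurable (radiusMajorant s c L) :=
  (measurable_one.indicator Metric.isClosed_closedBall.measurableSet).add <|
    Measurable.tsum fun _ =>
      measurable_const.indicator Metric.isClosed_closedBall.measurableSet

/-- By doubling, `s` cancels between the height and the width of the `n`-th term, leaving at most `8
L / 2^n`. These sum to `16 L`, and the central ball adds `4 L`. -/
theorem lintegral_radiusMajorant_le {s : ℝ → ℝ} (hs : ∀ r, 0 < r → 0 < s r)
    (hdouble : ∀ r, 0 < r → s (r / 2) ≤ 2 * s r) (c : ℝ) {L : ℝ} (hL : 0 < L) :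
    ∫⁻ x, radiusMajorant s c L x ≤ 20 * ENNReal.ofReal L := by
  unfold radiusMajorant
  rw [lintegral_add_left
      (measurable_one.indicator Metric.isClosed_closedBall.measurableSet),
    lintegral_indicator_one Metric.isClosed_closedBall.measurableSet, Real.volume_closedBall,
    lintegral_tsum fun _ =>
      (measurable_const.indicator Metric.isClosed_closedBall.measurableSet).aemeasurable]
  have hterm : ∀ n : ℕ, ∫⁻ x, (Metric.closedBall c (2 * s (L / 2 ^ (n + 1)))).indicator
      (fun _ => ENNReal.ofReal (L / 2 ^ n / s (L / 2 ^ n))) x ≤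
      ENNReal.ofReal (8 * L) * 2⁻¹ ^ n := by
    intro n
    have hn : 0 < L / 2 ^ n := by positivity
    have h2 : L / 2 ^ (n + 1) = L / 2 ^ n / 2 := by rw [pow_succ]; field_simp
    have hd := hdouble _ hn
    have hp := hs _ hn
    have hpow : (2⁻¹ : ℝ≥0∞) ^ n = ENNReal.ofReal (2⁻¹ ^ n) := by
      rw [ENNReal.ofReal_pow (by norm_num), ENNReal.ofReal_inv_of_pos two_pos,
        ENNReal.ofReal_ofNat]
    rw [lintegral_indicator_const Metric.isClosed_closedBall.measurableSet,
      Real.volume_closedBall, hpow, ← ENNReal.ofReal_mul (by positivity),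
      ← ENNReal.ofReal_mul (by positivity), h2]
    apply ENNReal.ofReal_le_ofReal
    calc L / 2 ^ n / s (L / 2 ^ n) * (2 * (2 * s (L / 2 ^ n / 2)))
        ≤ L / 2 ^ n / s (L / 2 ^ n) * (2 * (2 * (2 * s (L / 2 ^ n)))) := by gcongr
      _ = 8 * L * 2⁻¹ ^ n := by rw [inv_pow]; field_simp; norm_num
  refine (add_le_add_right (ENNReal.tsum_le_tsum hterm) _).trans (le_of_eq ?_)
  rw [ENNReal.tsum_mul_left, ENNReal.tsum_geometric, ENNReal.one_sub_inv_two, inv_inv]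
  rw [← ENNReal.ofReal_ofNat 2, ← ENNReal.ofReal_ofNat 20,
    ← ENNReal.ofReal_mul (by positivity), ← ENNReal.ofReal_add (by positivity) (by positivity),
    ← ENNReal.ofReal_mul (by positivity)]
  congr 1
  ring

/-- If `s r ≤ L`, then `x` is within `2 L` of `c` and `r / s r ≤ 1` is enough. Otherwise `|x - c| ≤
2 s r`, and the term with `L / 2^(n+1) < r ≤ L / 2^n` works because `s` is decreasing. -/
theorem le_radiusMajorant {s : ℝ → ℝ} (hs : ∀ r, 0 < r → 0 < s r)
    (hanti : ∀ r r', 0 < r → r ≤ r' → s r' ≤ s r) {c L r x : ℝ} (hr : 0 < r) (hrL : r ≤ L)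
    (hrs : r ≤ s r) (hx : |x - c| ≤ s r + L) :
    ENNReal.ofReal (r / s r) ≤ radiusMajorant s c L x := by
  have hL : 0 < L := hr.trans_le hrL
  rcases le_total (s r) L with h | h
  · refine le_add_right ?_
    have hmem : x ∈ Metric.closedBall c (2 * L) := by
      rw [Metric.mem_closedBall, Real.dist_eq]; linarith
    rw [Set.indicator_of_mem hmem, Pi.one_apply, ENNReal.ofReal_le_one]
    exact div_le_one_of_le₀ hrs (hs r hr).le
  · refine le_add_left ?_
    obtain ⟨n, hn1, hn2⟩ := exists_nat_pow_near_of_lt_one (div_pos hr hL)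
      (div_le_one_of_le₀ hrL hL.le) (y := (2⁻¹ : ℝ)) (by norm_num) (by norm_num)
    have h1 : L / 2 ^ (n + 1) < r := by
      rw [lt_div_iff₀ hL, inv_pow] at hn1
      rwa [div_eq_inv_mul]
    have h2 : r ≤ L / 2 ^ n := by
      rw [div_le_iff₀ hL, inv_pow] at hn2
      rwa [div_eq_inv_mul]
    have hmem : x ∈ Metric.closedBall c (2 * s (L / 2 ^ (n + 1))) := by
      have := hanti (L / 2 ^ (n + 1)) r (by positivity) h1.le
      rw [Metric.mem_closedBall, Real.dist_eq]; linarith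
    refine le_trans ?_ (ENNReal.le_tsum n)
    rw [Set.indicator_of_mem hmem]
    apply ENNReal.ofReal_le_ofReal
    have := hs (L / 2 ^ n) (by positivity)
    exact div_le_div₀ (by positivity) h2 this (hanti r _ hr h2)

/-- A Carleson type estimate: for an open set `E`, the supremum of `r / s(r)` over the intervals
of centre `y` and radius `r` inside `E` with `|x - y| ≤ s(r)` has a majorant whose integral is
controlled by the measure of `E`. -/
theorem exists_majorant_of_isOpen {s : ℝ → ℝ} (hs : ∀ r, 0 < r → 0 < s r)
    (hanti : ∀ r r', 0 < r → r ≤ r' → s r' ≤ s r)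
    (hdouble : ∀ r, 0 < r → s (r / 2) ≤ 2 * s r)
    {E : Set ℝ} (hE : IsOpen E) (hfin : volume E ≠ ⊤) :
    ∃ H : ℝ → ℝ≥0∞, Measurable H ∧ ∫⁻ x, H x ≤ 20 * volume E ∧
      ∀ x y r : ℝ, 0 < r → r ≤ s r → Metric.ball y r ⊆ E → |x - y| ≤ s r →
        ENNReal.ofReal (r / s r) ≤ H x := by
  -- A ball inside `E` lies in a single component, so the sum of the majorants of the countably many
  -- components dominates the supremum.
  set 𝒥 : Set (Set ℝ) := (fun x => connectedComponentIn E x) '' E with h𝒥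
  have hopen : ∀ J ∈ 𝒥, IsOpen J := by
    rintro _ ⟨x, _, rfl⟩
    exact hE.connectedComponentIn
  have hne : ∀ J ∈ 𝒥, J.Nonempty := by
    rintro _ ⟨x, hx, rfl⟩
    exact ⟨x, mem_connectedComponentIn hx⟩
  have hsubE : ∀ J ∈ 𝒥, J ⊆ E := by
    rintro _ ⟨x, _, rfl⟩
    exact connectedComponentIn_subset E x
  have hord : ∀ J ∈ 𝒥, J.OrdConnected := by
    rintro _ ⟨x, _, rfl⟩
    exact isPreconnected_connectedComponentIn.ordConnected
  have hdisj : 𝒥.PairwiseDisjoint id := by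
    rintro _ ⟨x, _, rfl⟩ _ ⟨y, _, rfl⟩ hxy
    refine Set.disjoint_left.2 fun z hzx hzy => hxy ?_
    exact (connectedComponentIn_eq hzx).trans (connectedComponentIn_eq hzy).symm
  have hcount : 𝒥.Countable := hdisj.countable_of_isOpen hopen hne
  have hvol : ∀ J ∈ 𝒥, volume J ≠ ⊤ := fun J hJ =>
    ne_top_of_le_ne_top hfin (measure_mono (hsubE J hJ))
  have hpos : ∀ J ∈ 𝒥, 0 < (volume J).toReal := fun J hJ =>
    ENNReal.toReal_pos ((hopen J hJ).measure_pos volume (hne J hJ)).ne' (hvol J hJ)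
  have : Countable 𝒥 := hcount.to_subtype
  choose c hc using fun J : 𝒥 => hne J J.2
  refine ⟨fun x => ∑' J : 𝒥, radiusMajorant s (c J) (volume (J : Set ℝ)).toReal x,
    Measurable.tsum fun J => measurable_radiusMajorant _ _ _, ?_, ?_⟩
  · rw [lintegral_tsum fun J => (measurable_radiusMajorant _ _ _).aemeasurable]
    calc _ ≤ ∑' J : 𝒥, 20 * volume (J : Set ℝ) := by
          refine ENNReal.tsum_le_tsum fun J => ?_
          refine (lintegral_radiusMajorant_le hs hdouble _ (hpos J J.2)).trans ?_
          rw [ENNReal.ofReal_toReal (hvol J J.2)]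
      _ = 20 * volume (⋃ J ∈ 𝒥, id J) := by
          rw [ENNReal.tsum_mul_left,
            measure_biUnion hcount hdisj fun J hJ => (hopen J hJ).measurableSet]
          rfl
      _ ≤ 20 * volume E := by
          gcongr
          exact Set.iUnion₂_subset hsubE
  · intro x y r hr hrs hball hxy
    have hyE : y ∈ E := hball (Metric.mem_ball_self hr)
    let J : 𝒥 := ⟨connectedComponentIn E y, y, hyE, rfl⟩
    have hyJ : y ∈ (J : Set ℝ) := mem_connectedComponentIn hyE
    have hballJ : Metric.ball y r ⊆ (J : Set ℝ) :=
      (convex_ball y r).isPreconnected.subset_connectedComponentIn (Metric.mem_ball_self hr) hball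
    have hrL : 2 * r ≤ (volume (J : Set ℝ)).toReal := by
      rw [← ENNReal.ofReal_le_iff_le_toReal (hvol J J.2), ← Real.volume_ball y]
      exact measure_mono hballJ
    have hyc : |y - c J| ≤ (volume (J : Set ℝ)).toReal := by
      rw [← ENNReal.ofReal_le_iff_le_toReal (hvol J J.2), ← Real.volume_interval]
      exact measure_mono ((hord J J.2).uIcc_subset (hc J) hyJ)
    refine le_trans ?_ (ENNReal.le_tsum J)
    refine le_radiusMajorant hs hanti hr (by linarith) hrs ?_
    calc |x - c J| ≤ |x - y| + |y - c J| := abs_sub_le _ _ _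
      _ ≤ _ := add_le_add hxy hyc

/-! ### Measurability of the maximal function -/

theorem setOf_abs_sub_le_eq_closedBall (y r : ℝ) :
    {y' : ℝ | |y - y'| ≤ r} = Metric.closedBall y r := by
  ext z
  rw [Set.mem_ofPred_eq, Metric.mem_closedBall', Real.dist_eq]

theorem fracMaximal_congr_ae (ℓ : ℕ) (lam : ℝ) {w w' : ℝ → ℝ≥0∞} (h : w =ᵐ[volume] w') :
    fracMaximal ℓ lam w = fracMaximal ℓ lam w' := by
  ext x
  unfold fracMaximal
  refine iSup_congr fun q => iSup_congr fun _ => ?_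
  rw [lintegral_congr_ae (ae_restrict_of_ae h)]

/-- Shrinking `r` slightly widens the approach region, so the closed condition on `x` becomes
strict, hence open. The loss in the integral is negligible because the boundary of the interval is
null, and the denominator only decreases. This gives measurability of an uncountable supremum. -/
theorem lowerSemicontinuous_fracMaximal {ℓ : ℕ} (hℓ : 2 ≤ ℓ) {lam : ℝ} (hlam : 0 < lam)
    (w : ℝ → ℝ≥0∞) : LowerSemicontinuous (fracMaximal ℓ lam w) := by
  have ha : (0 : ℝ) < 1 / ((ℓ : ℝ) - 1) := by
    have : (2 : ℝ) ≤ ℓ := by exact_mod_cast hℓ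
    exact one_div_pos.2 (by linarith)
  intro x t ht
  unfold fracMaximal at ht
  simp only [lt_iSup_iff] at ht
  obtain ⟨⟨y, r⟩, ⟨hr1, hr2, hxy⟩, ht⟩ := ht
  simp only at hr1 hr2 hxy ht
  have hr : 0 < r := (inv_pos.2 hlam).trans hr1
  have hD : ∀ r : ℝ, 0 < r → ENNReal.ofReal ((lam * r) ^ (1 / ((ℓ : ℝ) - 1))) ≠ 0 := by
    intro r hr
    exact (ENNReal.ofReal_pos.2 (Real.rpow_pos_of_pos (mul_pos hlam hr) _)).ne'
  -- The strict bound `lam⁻¹ < r` leaves room for smaller admissible radii.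
  obtain ⟨u, hu, hmem, hlim⟩ := exists_seq_strictMono_tendsto' hr1
  have hball : Metric.ball y r = ⋃ n, Metric.closedBall y (u n) := by
    ext z
    rw [Set.mem_iUnion]
    constructor
    · intro hz
      obtain ⟨n, hn⟩ := (hlim.eventually (lt_mem_nhds (Metric.mem_ball.1 hz))).exists
      exact ⟨n, hn.le⟩
    · rintro ⟨n, hn⟩
      exact lt_of_le_of_lt hn (hmem n).2
  have hdir : Directed (· ⊆ ·) fun n => Metric.closedBall y (u n) :=
    Monotone.directed_le fun _ _ hmn => Metric.closedBall_subset_closedBall (hu.monotone hmn)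
  rw [setOf_abs_sub_le_eq_closedBall, ENNReal.lt_div_iff_mul_lt (Or.inl (hD r hr))
    (Or.inl ENNReal.ofReal_ne_top), Real.closedBall_eq_Icc, ← setLIntegral_congr Ioo_ae_eq_Icc,
    ← Real.ball_eq_Ioo, hball, setLIntegral_iUnion_of_directed _ hdir, lt_iSup_iff] at ht
  obtain ⟨n, hn⟩ := ht
  have hu0 : 0 < u n := (inv_pos.2 hlam).trans (hmem n).1
  have hlt : lam * u n < lam * r := mul_lt_mul_of_pos_left (hmem n).2 hlam
  have hs : |y - x| < (lam * u n) ^ (-(1 / ((ℓ : ℝ) - 1))) :=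
    hxy.trans_lt (Real.rpow_lt_rpow_of_neg (mul_pos hlam hu0) hlt (neg_lt_zero.2 ha))
  have hcont : Continuous fun x' : ℝ => |y - x'| := by fun_prop
  filter_upwards [hcont.continuousAt.eventually (gt_mem_nhds hs)] with x' hx'
  unfold fracMaximal
  simp only [lt_iSup_iff]
  refine ⟨(y, u n), ⟨(hmem n).1, (hmem n).2.le.trans hr2, hx'.le⟩, ?_⟩
  rw [setOf_abs_sub_le_eq_closedBall, ENNReal.lt_div_iff_mul_lt (Or.inl (hD _ hu0))
    (Or.inl ENNReal.ofReal_ne_top)]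
  refine lt_of_le_of_lt (mul_le_mul_right (ENNReal.ofReal_le_ofReal ?_) _) hn
  exact Real.rpow_le_rpow (mul_pos hlam hu0).le hlt.le ha.le

/-! ### Strong type bound for the level sets -/

/-- The Hardy–Littlewood maximal theorem in terms of dyadic level sets. -/
theorem tsum_zpow_rpow_mul_volume_averageLevelSet_le {w : ℝ → ℝ≥0∞} (hw : Measurable w)
    (hfin : ∀ y, w y ≠ ⊤) {p : ℝ} (hp : 1 < p) :
    ∑' k : ℤ, ((2 : ℝ≥0∞) ^ k) ^ p * volume (averageLevelSet w (2 ^ k)) ≤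
      10 * ((1 - 2 ^ (-(p - 1)))⁻¹ * 2 ^ (p - 1)) * ∫⁻ y, w y ^ p := by
  have hp' : 0 < p - 1 := sub_pos.2 hp
  have h0 : ∀ k : ℤ, (2 : ℝ≥0∞) ^ k ≠ 0 := fun k =>
    (ENNReal.zpow_pos two_ne_zero ENNReal.ofNat_ne_top k).ne'
  have htop : ∀ k : ℤ, (2 : ℝ≥0∞) ^ k ≠ ⊤ := fun k =>
    ENNReal.zpow_ne_top two_ne_zero ENNReal.ofNat_ne_top k
  have hmeas : ∀ k : ℤ, Measurable ({z | (2 : ℝ≥0∞) ^ k / 2 < w z}.indicator w) := fun k =>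
    hw.indicator (measurableSet_lt measurable_const hw)
  have hterm : ∀ k : ℤ, ((2 : ℝ≥0∞) ^ k) ^ p * volume (averageLevelSet w (2 ^ k)) ≤
      ∫⁻ y, 10 * (((2 : ℝ≥0∞) ^ k) ^ (p - 1) * {z | (2 : ℝ≥0∞) ^ k / 2 < w z}.indicator w y) := by
    intro k
    rw [lintegral_const_mul _ ((hmeas k).const_mul _), lintegral_const_mul _ (hmeas k)]
    refine (mul_le_mul_right (volume_averageLevelSet_le hw (h0 k) (htop k)) _).trans (le_of_eq ?_)
    rw [ENNReal.rpow_sub _ _ (h0 k) (htop k), ENNReal.rpow_one, div_eq_mul_inv (_ ^ p)]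
    ring
  refine (ENNReal.tsum_le_tsum hterm).trans ?_
  rw [← lintegral_tsum fun k => (((hmeas k).const_mul _).const_mul _).aemeasurable,
    ← lintegral_const_mul _ (hw.pow_const p)]
  refine lintegral_mono fun y => ?_
  -- The truncation to large values pays off here: at a fixed `y` only `2^k < 2 w(y)` contributes,
  -- and the series is geometric since `p - 1 > 0`.
  have hpt : ∀ k : ℤ, 10 * (((2 : ℝ≥0∞) ^ k) ^ (p - 1) *
      {z | (2 : ℝ≥0∞) ^ k / 2 < w z}.indicator w y) =
      10 * w y * (if (2 : ℝ≥0∞) ^ k < 2 * w y then ((2 : ℝ≥0∞) ^ k) ^ (p - 1) else 0) := by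
    intro k
    have hiff : (2 : ℝ≥0∞) ^ k / 2 < w y ↔ (2 : ℝ≥0∞) ^ k < 2 * w y := by
      rw [ENNReal.div_lt_iff (Or.inl two_ne_zero) (Or.inl ENNReal.ofNat_ne_top), mul_comm]
    simp only [Set.indicator_apply, Set.mem_ofPred_eq, hiff]
    split_ifs
    · ring
    · simp
  simp only [hpt]
  rw [ENNReal.tsum_mul_left]
  refine (mul_le_mul_right (tsum_zpow_rpow_lt_le hp'
    (ENNReal.mul_ne_top ENNReal.ofNat_ne_top (hfin y))) _).trans (le_of_eq ?_)
  have hpow : w y ^ p = w y * w y ^ (p - 1) := by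
    rcases eq_or_ne (w y) 0 with h | h
    · rw [h, ENNReal.zero_rpow_of_pos (by linarith), zero_mul]
    · nth_rw 2 [← ENNReal.rpow_one (w y)]
      rw [← ENNReal.rpow_add _ _ h (hfin y), add_sub_cancel]
  rw [ENNReal.mul_rpow_of_nonneg _ _ hp'.le, hpow]
  ring

/-! ### Scaling of the approach region and the strong type estimate -/

/-- The width of the approach region dominates the radius. -/
theorem le_approachWidth {ℓ : ℕ} (hℓ : 2 ≤ ℓ) {lam : ℝ} (hlam : 0 < lam) {r : ℝ}
    (hr0 : 0 < r) (hr : r ≤ lam ^ (-(1 / (ℓ : ℝ)))) :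
    r ≤ (lam * r) ^ (-(1 / ((ℓ : ℝ) - 1))) := by
  have h2 : (2 : ℝ) ≤ ℓ := by exact_mod_cast hℓ
  have h1 : (0 : ℝ) < (ℓ : ℝ) - 1 := by linarith
  have ha : (0 : ℝ) < 1 / ((ℓ : ℝ) - 1) := one_div_pos.2 h1
  refine hr.trans ?_
  -- The largest admissible radius is the fixed point of the decreasing function `r ↦ (λ
  -- r)^{-1/(ℓ-1)}`.
  calc lam ^ (-(1 / (ℓ : ℝ)))
      = (lam * lam ^ (-(1 / (ℓ : ℝ)))) ^ (-(1 / ((ℓ : ℝ) - 1))) := by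
        nth_rw 2 [← Real.rpow_one lam]
        rw [← Real.rpow_add hlam, ← Real.rpow_mul hlam.le]
        congr 1
        field_simp
        ring
    _ ≤ _ := Real.rpow_le_rpow_of_nonpos (by positivity)
        (mul_le_mul_of_nonneg_left hr hlam.le) (neg_nonpos.2 ha.le)

/-- The scaling identity behind the choice of the exponent `ℓ / (ℓ - 2)`. -/
theorem radius_mul_approachWidth_rpow {ℓ : ℝ} (hℓ : 2 < ℓ) {lam r : ℝ} (hlam : 0 < lam)
    (hr : 0 < r) :
    (r * (lam * r) ^ (-(1 / (ℓ - 1)))) ^ (ℓ / (ℓ - 2)) =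
      (lam ^ (-(2 / ℓ))) ^ (ℓ / (ℓ - 2)) * (r / (lam * r) ^ (-(1 / (ℓ - 1)))) := by
  have h1 : ℓ - 1 ≠ 0 := by linarith
  have h2 : ℓ - 2 ≠ 0 := by linarith
  have h0 : ℓ ≠ 0 := by linarith
  have hs : 0 < (lam * r) ^ (-(1 / (ℓ - 1))) := by positivity
  -- After logarithms the identity is linear in `log lam` and `log r`.
  refine Real.log_injOn_pos (Set.mem_Ioi.2 (by positivity)) (Set.mem_Ioi.2 (by positivity)) ?_
  rw [Real.log_rpow (mul_pos hr hs), Real.log_mul hr.ne' hs.ne',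
    Real.log_mul (by positivity) (by positivity), Real.log_rpow (mul_pos hlam hr),
    Real.log_rpow (Real.rpow_pos_of_pos hlam _), Real.log_rpow hlam, Real.log_div hr.ne' hs.ne',
    Real.log_rpow (mul_pos hlam hr), Real.log_mul hlam.ne' hr.ne']
  field_simp
  ring

theorem approachWidth_half_le {a : ℝ} (ha : a ≤ 1) {lam r : ℝ} (hlam : 0 < lam)
    (hr : 0 < r) : (lam * (r / 2)) ^ (-a) ≤ 2 * (lam * r) ^ (-a) := by
  have h : lam * (r / 2) = lam * r * 2⁻¹ := by ring
  rw [h, Real.mul_rpow (by positivity) (by positivity), mul_comm, Real.inv_rpow zero_le_two,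
    Real.rpow_neg zero_le_two, inv_inv]
  refine mul_le_mul_of_nonneg_right ?_ (by positivity)
  calc (2 : ℝ) ^ a ≤ 2 ^ (1 : ℝ) := Real.rpow_le_rpow_of_exponent_le one_le_two ha
    _ = 2 := Real.rpow_one 2

/-- The pointwise bound of the fractional maximal function by majorants attached to the dyadic
level sets. -/
theorem fracMaximal_rpow_le {ℓ : ℕ} (hℓ : 2 < ℓ) {lam : ℝ} (hlam : 0 < lam)
    (w : ℝ → ℝ≥0∞) {H : ℤ → ℝ → ℝ≥0∞}
    (hH : ∀ (k : ℤ) (x y r : ℝ), 0 < r → r ≤ (lam * r) ^ (-(1 / ((ℓ : ℝ) - 1))) →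
      Metric.ball y r ⊆ averageLevelSet w (2 ^ k) →
      |x - y| ≤ (lam * r) ^ (-(1 / ((ℓ : ℝ) - 1))) →
      ENNReal.ofReal (r / (lam * r) ^ (-(1 / ((ℓ : ℝ) - 1)))) ≤ H k x) (x : ℝ) :
    fracMaximal ℓ lam w x ^ ((ℓ : ℝ) / (ℓ - 2)) ≤
      (4 * ENNReal.ofReal (lam ^ (-(2 / (ℓ : ℝ))))) ^ ((ℓ : ℝ) / (ℓ - 2)) *
        ∑' k : ℤ, ((2 : ℝ≥0∞) ^ k) ^ ((ℓ : ℝ) / (ℓ - 2)) * H k x := by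
  have hℓ' : (2 : ℝ) < ℓ := by exact_mod_cast hℓ
  set p : ℝ := (ℓ : ℝ) / (ℓ - 2) with hpdef
  have hp : 0 < p := div_pos (by linarith) (by linarith)
  rw [← ENNReal.le_rpow_inv_iff hp]
  refine iSup₂_le fun q hq => ?_
  rw [ENNReal.le_rpow_inv_iff hp, setOf_abs_sub_le_eq_closedBall]
  obtain ⟨y, r⟩ := q
  obtain ⟨hr1, hr2, hxy⟩ := hq
  simp only at hr1 hr2 hxy ⊢
  have hr : 0 < r := (inv_pos.2 hlam).trans hr1
  have hrs := le_approachWidth hℓ.le hlam hr hr2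
  set s := (lam * r) ^ (-(1 / ((ℓ : ℝ) - 1))) with hs
  have hspos : 0 < s := by positivity
  have hsinv : (lam * r) ^ (1 / ((ℓ : ℝ) - 1)) = s⁻¹ := by
    rw [hs, Real.rpow_neg (by positivity), inv_inv]
  have hr2' : ENNReal.ofReal (2 * r) ≠ 0 := (ENNReal.ofReal_pos.2 (by positivity)).ne'
  set A := (∫⁻ y' in Metric.closedBall y r, w y') / ENNReal.ofReal (2 * r) with hA
  have hAr : ∫⁻ y' in Metric.closedBall y r, w y' = A * ENNReal.ofReal (2 * r) :=
    (ENNReal.div_mul_cancel hr2' ENNReal.ofReal_ne_top).symm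
  have hval : (∫⁻ y' in Metric.closedBall y r, w y') /
      ENNReal.ofReal ((lam * r) ^ (1 / ((ℓ : ℝ) - 1))) =
      2 * (ENNReal.ofReal (r * s) * A) := by
    rw [hAr, hsinv, ENNReal.ofReal_inv_of_pos hspos, div_eq_mul_inv, inv_inv,
      ENNReal.ofReal_mul zero_le_two, ENNReal.ofReal_mul hr.le, ENNReal.ofReal_ofNat]
    ring
  have hscale : ENNReal.ofReal (r * s) ^ p =
      ENNReal.ofReal (lam ^ (-(2 / (ℓ : ℝ)))) ^ p * ENNReal.ofReal (r / s) := by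
    rw [ENNReal.ofReal_rpow_of_pos (by positivity), ENNReal.ofReal_rpow_of_pos (by positivity),
      ← ENNReal.ofReal_mul (by positivity), hs, hpdef, radius_mul_approachWidth_rpow hℓ' hlam hr]
  have hlevel : ∀ k : ℤ, ENNReal.ofReal (r / s) *
      (if (2 : ℝ≥0∞) ^ k < A then ((2 : ℝ≥0∞) ^ k) ^ p else 0) ≤
      ((2 : ℝ≥0∞) ^ k) ^ p * H k x := by
    intro k
    split_ifs with hk
    · rw [mul_comm]
      refine mul_le_mul_right (hH k x y r hr hrs ?_ (by rwa [abs_sub_comm])) _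
      have hmem : (y, r) ∈ averageIndices w (2 ^ k) :=
        ⟨hr, (ENNReal.lt_div_iff_mul_lt (Or.inl hr2') (Or.inl ENNReal.ofReal_ne_top)).1 hk⟩
      exact Set.subset_biUnion_of_mem (u := fun q : ℝ × ℝ => Metric.ball q.1 q.2) hmem
    · simp
  rw [hval, ENNReal.mul_rpow_of_nonneg _ _ hp.le, ENNReal.mul_rpow_of_nonneg _ _ hp.le, hscale]
  -- One factor `2` comes from the interval length `2 r`, the other from rounding `A` to a power of
  -- two.
  have h4 : (4 : ℝ≥0∞) = 2 * 2 := by norm_num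
  rw [h4, ENNReal.mul_rpow_of_nonneg _ _ hp.le, ENNReal.mul_rpow_of_nonneg _ _ hp.le]
  calc _ ≤ 2 ^ p * (ENNReal.ofReal (lam ^ (-(2 / (ℓ : ℝ)))) ^ p * ENNReal.ofReal (r / s) *
        (2 ^ p * ∑' k : ℤ, (if (2 : ℝ≥0∞) ^ k < A then ((2 : ℝ≥0∞) ^ k) ^ p else 0))) := by
        gcongr
        exact rpow_le_tsum_zpow_rpow hp A
    _ = 2 ^ p * 2 ^ p * ENNReal.ofReal (lam ^ (-(2 / (ℓ : ℝ)))) ^ p *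
        ∑' k : ℤ, ENNReal.ofReal (r / s) *
          (if (2 : ℝ≥0∞) ^ k < A then ((2 : ℝ≥0∞) ^ k) ^ p else 0) := by
        rw [ENNReal.tsum_mul_left]
        ring
    _ ≤ _ := mul_le_mul_right (ENNReal.tsum_le_tsum hlevel) _

/-- The strong type estimate for the fractional maximal function, in integral form. -/
theorem lintegral_fracMaximal_rpow_le {ℓ : ℕ} (hℓ : 2 < ℓ) :
    ∃ K : ℝ≥0∞, K ≠ ⊤ ∧ ∀ lam : ℝ, 0 < lam → ∀ w : ℝ → ℝ≥0∞, Measurable w →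
      (∀ y, w y ≠ ⊤) → ∫⁻ y, w y ^ ((ℓ : ℝ) / (ℓ - 2)) ≠ ⊤ →
      ∫⁻ x, fracMaximal ℓ lam w x ^ ((ℓ : ℝ) / (ℓ - 2)) ≤
        K * ENNReal.ofReal (lam ^ (-(2 / (ℓ : ℝ)))) ^ ((ℓ : ℝ) / (ℓ - 2)) *
          ∫⁻ y, w y ^ ((ℓ : ℝ) / (ℓ - 2)) := by
  have hℓ' : (2 : ℝ) < ℓ := by exact_mod_cast hℓ
  set p : ℝ := (ℓ : ℝ) / (ℓ - 2) with hpdef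
  have hp : 1 < p := (one_lt_div (by linarith)).2 (by linarith)
  have hp0 : 0 < p := by linarith
  set K₀ : ℝ≥0∞ := 10 * ((1 - 2 ^ (-(p - 1)))⁻¹ * 2 ^ (p - 1)) with hK₀
  have hK₀top : K₀ ≠ ⊤ := by
    have h1 : (2 : ℝ≥0∞) ^ (-(p - 1)) < 1 :=
      ENNReal.rpow_lt_one_of_one_lt_of_neg ENNReal.one_lt_two (by linarith)
    refine ENNReal.mul_ne_top ENNReal.ofNat_ne_top (ENNReal.mul_ne_top ?_ ?_)
    · exact ENNReal.inv_ne_top.2 (tsub_pos_of_lt h1).ne'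
    · exact ENNReal.rpow_ne_top_of_nonneg (by linarith) ENNReal.ofNat_ne_top
  refine ⟨4 ^ p * (20 * K₀), ENNReal.mul_ne_top
    (ENNReal.rpow_ne_top_of_nonneg hp0.le ENNReal.ofNat_ne_top)
    (ENNReal.mul_ne_top ENNReal.ofNat_ne_top hK₀top), fun lam hlam w hw hfin hint => ?_⟩
  have hHL := tsum_zpow_rpow_mul_volume_averageLevelSet_le hw hfin hp
  -- Each term of a convergent series is finite; the Carleson estimate needs level sets of finite
  -- measure.
  have hvol : ∀ k : ℤ, volume (averageLevelSet w (2 ^ k)) ≠ ⊤ := by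
    intro k
    have h := ENNReal.ne_top_of_tsum_ne_top
      (ne_top_of_le_ne_top (ENNReal.mul_ne_top hK₀top hint) hHL) k
    refine fun htop => h ?_
    rw [htop, ENNReal.mul_top]
    exact (ENNReal.rpow_pos (ENNReal.zpow_pos two_ne_zero ENNReal.ofNat_ne_top k)
      (ENNReal.zpow_ne_top two_ne_zero ENNReal.ofNat_ne_top k)).ne'
  have ha0 : (0 : ℝ) ≤ 1 / ((ℓ : ℝ) - 1) := one_div_nonneg.2 (by linarith)
  have ha1 : 1 / ((ℓ : ℝ) - 1) ≤ 1 := (div_le_one (by linarith)).2 (by linarith)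
  choose H hHm hHint hH using fun k : ℤ =>
    exists_majorant_of_isOpen (s := fun r => (lam * r) ^ (-(1 / ((ℓ : ℝ) - 1))))
      (fun r hr => by positivity)
      (fun r r' hr hrr' => Real.rpow_le_rpow_of_nonpos (by positivity)
        (mul_le_mul_of_nonneg_left hrr' hlam.le) (neg_nonpos.2 ha0))
      (fun r hr => approachWidth_half_le ha1 hlam hr)
      (isOpen_averageLevelSet w (2 ^ k)) (hvol k)
  calc ∫⁻ x, fracMaximal ℓ lam w x ^ p
      ≤ ∫⁻ x, (4 * ENNReal.ofReal (lam ^ (-(2 / (ℓ : ℝ))))) ^ p *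
          ∑' k : ℤ, ((2 : ℝ≥0∞) ^ k) ^ p * H k x :=
        lintegral_mono fun x => fracMaximal_rpow_le hℓ hlam w hH x
    _ = (4 * ENNReal.ofReal (lam ^ (-(2 / (ℓ : ℝ))))) ^ p *
          ∑' k : ℤ, ((2 : ℝ≥0∞) ^ k) ^ p * ∫⁻ x, H k x := by
        rw [lintegral_const_mul _ (Measurable.tsum fun k => (hHm k).const_mul _),
          lintegral_tsum fun k => ((hHm k).const_mul _).aemeasurable]
        congr 1
        exact tsum_congr fun k => lintegral_const_mul _ (hHm k)
    _ ≤ (4 * ENNReal.ofReal (lam ^ (-(2 / (ℓ : ℝ))))) ^ p *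
          ∑' k : ℤ, 20 * (((2 : ℝ≥0∞) ^ k) ^ p * volume (averageLevelSet w (2 ^ k))) := by
        refine mul_le_mul_right (ENNReal.tsum_le_tsum fun k => ?_) _
        rw [mul_left_comm]
        exact mul_le_mul_right (hHint k) _
    _ ≤ (4 * ENNReal.ofReal (lam ^ (-(2 / (ℓ : ℝ))))) ^ p * (20 * (K₀ * ∫⁻ y, w y ^ p)) := by
        rw [ENNReal.tsum_mul_left]
        gcongr
    _ = _ := by
        rw [ENNReal.mul_rpow_of_nonneg _ _ hp0.le]
        ring

/-- The uniform bound for the fractional maximal function at `ℓ = 2`. -/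
theorem fracMaximal_two_le {lam : ℝ} (hlam : 0 < lam) {w : ℝ → ℝ≥0∞} {B : ℝ≥0∞}
    (hB : ∀ᵐ y, w y ≤ B) (x : ℝ) :
    fracMaximal 2 lam w x ≤ ENNReal.ofReal (2 * lam⁻¹) * B := by
  refine iSup₂_le fun q hq => ?_
  have hr : 0 < q.2 := (inv_pos.2 hlam).trans hq.1
  rw [setOf_abs_sub_le_eq_closedBall]
  have hone : (1 : ℝ) / (((2 : ℕ) : ℝ) - 1) = 1 := by norm_num
  have hpos : 0 < lam * q.2 := mul_pos hlam hr
  rw [hone, Real.rpow_one]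
  refine ENNReal.div_le_of_le_mul ?_
  calc ∫⁻ y in Metric.closedBall q.1 q.2, w y
      ≤ ∫⁻ _ in Metric.closedBall q.1 q.2, B := lintegral_mono_ae (ae_restrict_of_ae hB)
    _ = ENNReal.ofReal (2 * lam⁻¹) * B * ENNReal.ofReal (lam * q.2) := by
        rw [setLIntegral_const, Real.volume_closedBall, mul_right_comm,
          ← ENNReal.ofReal_mul (by positivity), mul_comm B]
        congr 2
        field_simp

/-! ### The conjugate exponent and the final bound -/

theorem conjExponent_natCast_div_two {ℓ : ℕ} (hℓ : 2 < ℓ) :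
    ENNReal.conjExponent ((ℓ : ℝ≥0∞) / 2) = ENNReal.ofReal ((ℓ : ℝ) / (ℓ - 2)) := by
  have hℓ' : (2 : ℝ) < ℓ := by exact_mod_cast hℓ
  have h : ((ℓ : ℝ≥0∞) / 2) - 1 = ENNReal.ofReal ((ℓ : ℝ) / 2 - 1) := by
    rw [ENNReal.ofReal_sub _ zero_le_one, ENNReal.ofReal_div_of_pos two_pos,
      ENNReal.ofReal_natCast, ENNReal.ofReal_ofNat, ENNReal.ofReal_one]
  have h2 : 0 < (ℓ : ℝ) / 2 - 1 := by linarith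
  rw [ENNReal.conjExponent, h, ← ENNReal.ofReal_inv_of_pos h2, ← ENNReal.ofReal_one,
    ← ENNReal.ofReal_add zero_le_one (by positivity)]
  congr 1
  have h3 : (ℓ : ℝ) - 2 ≠ 0 := by linarith
  have h4 : (ℓ : ℝ) / 2 - 1 = (ℓ - 2) / 2 := by ring
  rw [h4]
  field_simp
  ring

theorem mainTheorem3 (ℓ : ℕ) (hℓ : 2 ≤ ℓ) :
    ∃ C : ℝ, 0 < C ∧ ∀ (lam : ℝ), 1 ≤ lam →
      ∀ f : ℝ → ℂ, MemLp f (ENNReal.conjExponent ((ℓ : ℝ≥0∞) / 2)) volume →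
        MemLp (fracMaximal ℓ lam (fun y => ‖f y‖ₑ))
          (ENNReal.conjExponent ((ℓ : ℝ≥0∞) / 2)) volume ∧
        eLpNorm (fracMaximal ℓ lam (fun y => ‖f y‖ₑ))
            (ENNReal.conjExponent ((ℓ : ℝ≥0∞) / 2)) volume ≤
          ENNReal.ofReal (C * lam ^ (-(2 / (ℓ : ℝ)))) *
            eLpNorm f (ENNReal.conjExponent ((ℓ : ℝ≥0∞) / 2)) volume := by
  suffices h : ∃ C : ℝ, 0 < C ∧ ∀ (lam : ℝ), 1 ≤ lam →
      ∀ f : ℝ → ℂ, MemLp f (ENNReal.conjExponent ((ℓ : ℝ≥0∞) / 2)) volume →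
        eLpNorm (fracMaximal ℓ lam (fun y => ‖f y‖ₑ))
            (ENNReal.conjExponent ((ℓ : ℝ≥0∞) / 2)) volume ≤
          ENNReal.ofReal (C * lam ^ (-(2 / (ℓ : ℝ)))) *
            eLpNorm f (ENNReal.conjExponent ((ℓ : ℝ≥0∞) / 2)) volume by
    obtain ⟨C, hC, hbound⟩ := h
    refine ⟨C, hC, fun lam hlam f hf => ⟨⟨?_, ?_⟩, hbound lam hlam f hf⟩⟩
    · exact (lowerSemicontinuous_fracMaximal hℓ (by linarith) _).measurable.aestronglyMeasurable
    · exact (hbound lam hlam f hf).trans_lt (ENNReal.mul_lt_top ENNReal.ofReal_lt_top hf.2)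
  rcases hℓ.eq_or_lt with rfl | hℓ2
  · have htop : ENNReal.conjExponent (((2 : ℕ) : ℝ≥0∞) / 2) = ⊤ := by
      rw [ENNReal.conjExponent, Nat.cast_ofNat,
        ENNReal.div_self two_ne_zero ENNReal.ofNat_ne_top]
      simp
    rw [htop]
    refine ⟨2, two_pos, fun lam hlam f _ => ?_⟩
    have hlam0 : 0 < lam := by linarith
    have hexp : lam ^ (-(2 / ((2 : ℕ) : ℝ))) = lam⁻¹ := by
      rw [Nat.cast_ofNat, div_self two_ne_zero, Real.rpow_neg_one]
    rw [hexp, eLpNorm_exponent_top, eLpNorm_exponent_top]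
    refine eLpNormEssSup_le_of_ae_enorm_bound (Filter.Eventually.of_forall fun x => ?_)
    exact fracMaximal_two_le hlam0 (enorm_ae_le_eLpNormEssSup f volume) x
  · obtain ⟨K, hK, hbound⟩ := lintegral_fracMaximal_rpow_le hℓ2
    have hℓ' : (2 : ℝ) < ℓ := by exact_mod_cast hℓ2
    rw [conjExponent_natCast_div_two hℓ2]
    set p : ℝ := (ℓ : ℝ) / (ℓ - 2) with hpdef
    have hp : 0 < p := div_pos (by linarith) (by linarith)
    have hKp : K ^ (1 / p) ≠ ⊤ := ENNReal.rpow_ne_top_of_nonneg (by positivity) hK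
    -- Adding `1` makes the constant positive without a lower bound on `K`.
    refine ⟨(K ^ (1 / p)).toReal + 1, by positivity, fun lam hlam f hf => ?_⟩
    have hlam0 : 0 < lam := by linarith
    have hp1 : ENNReal.ofReal p ≠ 0 := (ENNReal.ofReal_pos.2 hp).ne'
    -- The integral estimate wants a measurable weight; passing to a representative of `f` leaves
    -- the maximal function unchanged at every point.
    obtain ⟨g, hg, hfg⟩ := hf.1
    have hw : (fun y => ‖f y‖ₑ) =ᵐ[volume] fun y => ‖g y‖ₑ := hfg.mono fun y hy => by
      simp only [hy]
    have hgint : ∫⁻ y, ‖g y‖ₑ ^ p ≠ ⊤ := by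
      have h := lintegral_rpow_enorm_lt_top_of_eLpNorm_lt_top hp1 ENNReal.ofReal_ne_top
        ((eLpNorm_congr_ae hfg).symm.trans_lt hf.2)
      rw [ENNReal.toReal_ofReal hp.le] at h
      exact h.ne
    have hmain := hbound lam hlam0 (fun y => ‖g y‖ₑ) hg.enorm (fun _ => enorm_ne_top) hgint
    rw [fracMaximal_congr_ae ℓ lam hw, eLpNorm_congr_ae hfg,
      eLpNorm_eq_lintegral_rpow_enorm_toReal hp1 ENNReal.ofReal_ne_top,
      eLpNorm_eq_lintegral_rpow_enorm_toReal hp1 ENNReal.ofReal_ne_top,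
      ENNReal.toReal_ofReal hp.le]
    simp only [enorm_eq_self]
    refine (ENNReal.rpow_le_rpow hmain (by positivity)).trans ?_
    rw [ENNReal.mul_rpow_of_nonneg _ _ (by positivity),
      ENNReal.mul_rpow_of_nonneg _ _ (by positivity), ← ENNReal.rpow_mul _ p,
      mul_one_div_cancel hp.ne', ENNReal.rpow_one]
    refine mul_le_mul_left ?_ _
    rw [ENNReal.ofReal_mul (by positivity)]
    refine mul_le_mul_left ?_ _
    rw [ENNReal.le_ofReal_iff_toReal_le hKp (by positivity)]
    linarith
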